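/- Let $r, k, s$ be integers with $k \ge 0$ and $0 < s \le r$. Let $V = C_1 \sqcup \dots \sqcup C_{k+1}$ be a finite set whose elements (vertices) are colored by $k+1$ colors, where each color class has $|C_i| = 2r-1$ elements. A subset $A \subseteq V$ is called a rainbow simplex if $|A \cap C_i| \le 1$ for every $i$. Let $\mathfrak{C}$ be the simplicial complex whose simplices are labeled by the tuples $(A_1, \dots, A_r; B)$ such that - $V = A_1 \sqcup \dots \sqcup A_r \sqcup B$ is a partition (empty parts are allowed) with $B \ne V$; - each $A_i$ is a rainbow simplex (in particular $|A_i| \le k+1$); - the number of indices $i$ with $|A_i| = k+1$ does not exceed $s$. The simplex with label $(A_1, \dots, A_r; B)$ is the join $A_1 * \dots * A_r$; that is, $\mathfrak{C}$ is a subcomplex of the $r$-fold join of the full simplex on $V$, the vertex set of the join is the disjoint union of $r$ copies of $V$, and the simplex consists of the elements of $A_i$ in the $i$-th copy, for $i = 1, \dots, r$. Then the geometric realization of $\mathfrak{C}$ is $(rk+s-2)$-connected. Here a space $X$ is called $n$-connected if, for every integer $l$ with $-1 \le l \le n$, every continuous map $S^l \to X$ extends to a continuous map $B^{l+1} \to X$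 (with $S^{-1} = \emptyset$ and $B^0$ a point, so that the case $l=-1$ says that $X$ is nonempty). -/

import Mathlib

open Finset

/-- The geometric realization of an abstract simplicial complex on a finite vertex type: the union,
inside the standard simplex (with the topology of `ι → ℝ`), of the closed simplices spanned by the
faces. -/
def geometricRealization {ι : Type*} [Fintype ι] (K : PreAbstractSimplicialComplex ι) :
    Set (ι → ℝ) :=
  {x | x ∈ stdSimplex ℝ ι ∧ ∃ σ ∈ K, ∀ v, v ∉ σ → x v = 0}

/-- A space `X` is `n`-connected (`n` an integer) if for every `l` with `-1 ≤ l ≤ n`, each continuous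
map from the sphere `S^l` to `X` extends to a continuous map from the ball `B^(l+1)` to `X`.
Here `j = l + 1`, so that `S^l` and `B^(l+1)` are the unit sphere and the closed unit ball of the
Euclidean space `ℝ^j`. For `j = 0` the sphere is empty and the ball is a point, so this case says
that `X` is nonempty. -/
def IsNConnected (n : ℤ) (X : Type*) [TopologicalSpace X] : Prop :=
  ∀ j : ℕ, (j : ℤ) ≤ n + 1 →
    ∀ f : C(Metric.sphere (0 : EuclideanSpace ℝ (Fin j)) 1, X),
      ∃ g : C(Metric.closedBall (0 : EuclideanSpace ℝ (Fin j)) 1, X),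
        ∀ x : Metric.sphere (0 : EuclideanSpace ℝ (Fin j)) 1,
          g ⟨x.1, Metric.sphere_subset_closedBall x.2⟩ = f x

section ConfigurationSpace

variable {V : Type*} {k r : ℕ}

/-- A set of vertices is a rainbow set if it contains at most one vertex of each color. -/
def IsRainbow (c : V → Fin (k + 1)) (A : Finset V) : Prop :=
  ∀ i, #{v ∈ A | c v = i} ≤ 1

theorem IsRainbow.subset {c : V → Fin (k + 1)} {A A' : Finset V} (h : IsRainbow c A)
    (hA : A' ⊆ A) : IsRainbow c A' :=
  fun i => (card_le_card (filter_subset_filter _ hA)).trans (h i)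

theorem IsRainbow.card_le {c : V → Fin (k + 1)} {A : Finset V} (h : IsRainbow c A) :
    #A ≤ k + 1 := by
  have h1 := card_eq_sum_card_fiberwise (f := c) (s := A) (t := univ) (fun _ _ => by simp)
  rw [h1]
  exact (sum_le_sum fun i _ => h i).trans (by simp)

variable [Fintype V] [DecidableEq V]

/-- The `i`-th component `A_i` of a simplex `σ = A_1 * ⋯ * A_r` of the `r`-fold join of the simplex
with vertex set `V`; the vertex set of this join is `Fin r × V`, the disjoint union of `r` copies
of `V`. -/
def joinPart (σ : Finset (Fin r × V)) (i : Fin r) : Finset V :=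
  {v | (i, v) ∈ σ}

/-- The configuration space of `r`-tuples of disjoint rainbow simplices, at most `s` of which have
`k + 1` vertices. The simplex with label `(A_1, …, A_r; B)` is the join `A_1 * ⋯ * A_r`, and `B` is
the complement of the union of the `A_i`, so `B ≠ V` says that the join is nonempty. -/
def configurationSpace (c : V → Fin (k + 1)) (r s : ℕ) :
    PreAbstractSimplicialComplex (Fin r × V) where
  faces := {σ | σ.Nonempty ∧
    (∀ i j, i ≠ j → Disjoint (joinPart σ i) (joinPart σ j)) ∧
    (∀ i, IsRainbow c (joinPart σ i)) ∧
    #{i | #(joinPart σ i) = k + 1} ≤ s}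
  isRelLowerSet_faces := by
    rintro σ ⟨hne, hd, hr, hs⟩
    refine ⟨hne, fun τ hτ hτne => ?_⟩
    have hsub : ∀ i, joinPart τ i ⊆ joinPart σ i := fun i v hv => by
      simp only [joinPart, mem_filter, mem_univ, true_and] at hv ⊢
      exact hτ hv
    refine ⟨hτne, fun i j hij => (hd i j hij).mono (hsub i) (hsub j),
      fun i => (hr i).subset (hsub i), (card_le_card fun i hi => ?_).trans hs⟩
    simp only [mem_filter, mem_univ, true_and] at hi ⊢
    exact le_antisymm (hr i).card_le (hi ▸ card_le_card (hsub i))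

end ConfigurationSpace

/-!
Label the vertex `(i, v)` of the join by its slot `(i, color of v)`. The simplices are then the
matchings between slots and elements of `V` whose set of slots is independent in the matroid of sets
of slots that contain at most `s` full rows, a matroid of rank `rk + s`.

For an arbitrary matroid in place of this one, such a family of matchings is built by deletion and
contraction of a slot `e`: if `e` is not a coloop, remove all edges at `e`; if it is, remove edges
until a chosen edge at `e` is isolated, which leaves a cone. By induction the links of the removed
edges are built from expansions and cells of high dimension, and so is the whole family. A sphere
of smaller dimension misses a point of each such cell after a small perturbation, so it can be
pushed off the cell; undoing all steps in turn contracts it to a point.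
-/

section Sphere

variable {X Y : Type*} [TopologicalSpace X] [TopologicalSpace Y]

theorem exists_closedBall_extension_of_nullhomotopic {E : Type*} [NormedAddCommGroup E]
    [NormedSpace ℝ E] [ProperSpace E] {f : C(Metric.sphere (0 : E) 1, Y)} (hf : f.Nullhomotopic) :
    ∃ g : C(Metric.closedBall (0 : E) 1, Y), ∀ x : Metric.sphere (0 : E) 1,
      g ⟨x.1, Metric.sphere_subset_closedBall x.2⟩ = f x := by
  obtain ⟨y, ⟨H⟩⟩ := hf
  rcases isEmpty_or_nonempty (Metric.sphere (0 : E) 1) with hS | ⟨⟨x₀⟩⟩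
  · exact ⟨.const _ y, hS.elim⟩
  let cone : C(unitInterval × Metric.sphere (0 : E) 1, Metric.closedBall (0 : E) 1) :=
    ⟨fun p => ⟨(p.1 : ℝ) • (p.2 : E), by
      simpa [norm_smul, abs_of_nonneg p.1.2.1] using p.1.2.2⟩, by fun_prop⟩
  have cone_surjective : Function.Surjective cone := by
    rintro ⟨x, hx⟩
    rw [mem_closedBall_zero_iff] at hx
    rcases eq_or_ne x 0 with rfl | hx0
    · exact ⟨(0, x₀), Subtype.ext (zero_smul ℝ _)⟩
    · exact ⟨(⟨‖x‖, norm_nonneg x, hx⟩, ⟨‖x‖⁻¹ • x, by simp [norm_smul, hx0]⟩),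
        Subtype.ext (smul_inv_smul₀ (norm_ne_zero_iff.2 hx0) x)⟩
  have cone_isQuotientMap : Topology.IsQuotientMap cone :=
    cone.continuous.isClosedMap.isQuotientMap cone.continuous cone_surjective
  let F : C(unitInterval × Metric.sphere (0 : E) 1, Y) :=
    ⟨fun p => H (unitInterval.symm p.1, p.2), by fun_prop⟩
  have factors : Function.FactorsThrough F cone := by
    rintro ⟨t, x⟩ ⟨t', x'⟩ h
    have h : (t : ℝ) • (x : E) = (t' : ℝ) • (x' : E) := congrArg Subtype.val h
    have ht : t = t' := Subtype.ext <| by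
      simpa [norm_smul, abs_of_nonneg t.2.1, abs_of_nonneg t'.2.1] using congrArg norm h
    subst ht
    rcases eq_or_ne t 0 with rfl | ht
    · simp [F]
    · rw [Subtype.ext (smul_right_injective E (unitInterval.coe_ne_zero.2 ht) h)]
  refine ⟨cone_isQuotientMap.lift F factors, fun x => ?_⟩
  have hx : cone (1, x) = ⟨x.1, Metric.sphere_subset_closedBall x.2⟩ :=
    Subtype.ext (one_smul ℝ _)
  have hlift := DFunLike.congr_fun (cone_isQuotientMap.lift_comp F factors) (1, x)
  rw [ContinuousMap.comp_apply, hx] at hlift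
  simpa [F] using hlift

theorem exists_homotopic_of_mem {B : Set Y} (f : C(X, B)) (H : C(unitInterval × X, Y))
    (hB : ∀ p, H p ∈ B) (h0 : ∀ x, H (0, x) = f x) :
    ∃ g : C(X, B), f.Homotopic g ∧ ∀ x, (g x : Y) = H (1, x) :=
  ⟨⟨fun x => ⟨H (1, x), hB _⟩, by fun_prop⟩,
    ⟨{  toFun := fun p => ⟨H p, hB p⟩
        map_zero_left := fun x => Subtype.ext (h0 x)
        map_one_left := fun _ => rfl }⟩, fun _ => rfl⟩

theorem nullhomotopic_of_deformation {A B : Set Y} (hAB : A ⊆ B)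
    (hA : ∀ g : C(X, A), g.Nullhomotopic) (f : C(X, B)) (H : C(unitInterval × X, Y))
    (hB : ∀ p, H p ∈ B) (h0 : ∀ x, H (0, x) = f x) (h1 : ∀ x, H (1, x) ∈ A) :
    f.Nullhomotopic := by
  obtain ⟨g, hfg, hg⟩ := exists_homotopic_of_mem f H hB h0
  let g' : C(X, A) := ⟨fun x => ⟨g x, hg x ▸ h1 x⟩, by fun_prop⟩
  obtain ⟨b, hb⟩ := (hA g').comp_right ⟨Set.inclusion hAB, continuous_inclusion hAB⟩
  exact ⟨b, hfg.trans hb⟩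

end Sphere

section GeneralPosition

open MeasureTheory Module

variable {E F : Type*} [NormedAddCommGroup E] [NormedSpace ℝ E] [FiniteDimensional ℝ E]
  [NormedAddCommGroup F] [NormedSpace ℝ F] [FiniteDimensional ℝ F]

theorem dense_compl_image_of_addHaar_eq_zero [MeasurableSpace E] [BorelSpace E] {μ : Measure E}
    [μ.IsAddHaarMeasure] {s : Set E} (hs : μ s = 0) (hEF : finrank ℝ E ≤ finrank ℝ F) {g : E → F}
    (hg : ContDiff ℝ 1 g) : Dense (g '' s)ᶜ := by
  rcases hEF.lt_or_eq with hEF | hEF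
  · exact (hg.dense_compl_range_of_finrank_lt_finrank hEF).mono
      (Set.compl_subset_compl.2 (Set.image_subset_range _ _))
  · let e : F ≃L[ℝ] E := ContinuousLinearEquiv.ofFinrankEq hEF.symm
    have image_null : μ ((e ∘ g) '' s) = 0 :=
      addHaar_image_eq_zero_of_differentiableOn_of_addHaar_eq_zero _
        (e.differentiable.comp (hg.differentiable one_ne_zero)).differentiableOn hs
    convert (Measure.dense_of_ae (compl_mem_ae_iff.2 image_null)).preimage
      e.toHomeomorph.isOpenMap using 1
    ext y
    simp

theorem exists_dist_lt_forall_ne [MeasurableSpace E] [BorelSpace E] {μ : Measure E}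
    [μ.IsAddHaarMeasure] {s : Set E} (hs : IsClosed s) (hμs : μ s = 0)
    (hEF : finrank ℝ E ≤ finrank ℝ F) (f : C(s, F)) (p : F) {ε : ℝ} (hε : 0 < ε) :
    ∃ g : C(s, F), (∀ x, dist (g x) (f x) < ε) ∧ ∀ x, g x ≠ p := by
  obtain ⟨f', hf'⟩ := f.exists_restrict_eq hs
  obtain ⟨g, hg, hgf, -⟩ := f'.continuous.exists_contDiff_approx 1 continuous_const
    (fun _ => half_pos hε)
  obtain ⟨c, hc, hcp⟩ := (dense_compl_image_of_addHaar_eq_zero hμs hEF hg).exists_dist_lt p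
    (half_pos hε)
  have hg_cont := hg.continuous
  refine ⟨⟨fun x => g x + (p - c), by fun_prop⟩, fun x => ?_, fun x hx => ?_⟩
  · have hfx : f' x = f x := DFunLike.congr_fun hf' x
    calc dist (g x + (p - c)) (f x) ≤ dist (g x + (p - c)) (g x) + dist (g x) (f x) :=
          dist_triangle _ _ _
      _ < ε / 2 + ε / 2 := by
          rw [dist_self_add_left, ← dist_eq_norm, ← hfx]
          exact add_lt_add hcp (hgf x)
      _ = ε := add_halves ε
  · refine hc ⟨x, x.2, ?_⟩
    exact add_right_cancel (b := p - c) (hx.trans (add_sub_cancel c p).symm)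

end GeneralPosition

section Polyhedron

variable {ι : Type*}

section Depth

/-- The largest multiple of `p` that can be subtracted from `x` while keeping the coordinates in `τ`
nonnegative, when `p` is positive on `τ`. -/
noncomputable def depth {τ : Finset ι} (hτ : τ.Nonempty) (p x : ι → ℝ) : ℝ :=
  τ.inf' hτ fun v => x v / p v

variable {τ : Finset ι} (hτ : τ.Nonempty) {p x : ι → ℝ}

theorem continuous_depth (p : ι → ℝ) : Continuous (depth hτ p) :=
  Continuous.finset_inf'_apply hτ fun v _ => (continuous_apply v).div_const _

theorem depth_mul_le {v : ι} (hv : v ∈ τ) (hp : 0 < p v) : depth hτ p x * p v ≤ x v :=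
  (le_div_iff₀ hp).1 (inf'_le _ hv)

theorem exists_depth_mul_eq (hp : ∀ v ∈ τ, 0 < p v) : ∃ v ∈ τ, depth hτ p x * p v = x v := by
  obtain ⟨v, hv, h⟩ := exists_mem_eq_inf' hτ fun v => x v / p v
  exact ⟨v, hv, by rw [depth, h, div_mul_cancel₀ _ (hp v hv).ne']⟩

theorem depth_nonneg (hp : ∀ v ∈ τ, 0 < p v) (hx : 0 ≤ x) : 0 ≤ depth hτ p x :=
  (le_inf'_iff _ _).2 fun v hv => div_nonneg (hx v) (hp v hv).le

theorem add_eq_of_add_smul_eq {d : ι → ℝ} (hp : ∀ v ∈ τ, 0 < p v) (hx : 0 ≤ x)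
    (hd : ∀ v ∈ τ, |d v| ≤ p v / 2) (h : x + min 1 (2 * depth hτ p x) • d = p) : x + d = p := by
  obtain ⟨v, hv, hdepth⟩ := exists_depth_mul_eq hτ (x := x) hp
  have hmin : 0 ≤ min 1 (2 * depth hτ p x) :=
    le_min zero_le_one (mul_nonneg zero_le_two (depth_nonneg hτ hp hx))
  have hstep : min 1 (2 * depth hτ p x) * d v ≤ p v / 2 :=
    calc min 1 (2 * depth hτ p x) * d v ≤ min 1 (2 * depth hτ p x) * |d v| := by
          gcongr
          exact le_abs_self _
      _ ≤ |d v| := mul_le_of_le_one_left (abs_nonneg _) (min_le_left _ _)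
      _ ≤ p v / 2 := hd v hv
  have hxv : x v + min 1 (2 * depth hτ p x) * d v = p v := congrFun h v
  have hhalf : 1 / 2 ≤ depth hτ p x := le_of_mul_le_mul_right (by linarith) (hp v hv)
  rwa [min_eq_left (by linarith), one_smul] at h

end Depth

variable [Fintype ι]

/-- The union of the closed simplices spanned by the members of a family of finite sets. The
realization of a simplicial complex is the case where the family is its set of faces; here families
containing the empty set are allowed as well. -/
def polyhedron (F : Set (Finset ι)) : Set (ι → ℝ) :=
  {x | x ∈ stdSimplex ℝ ι ∧ ∃ σ ∈ F, ∀ v ∉ σ, x v = 0}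

theorem polyhedron_mono {F F' : Set (Finset ι)} (h : F ⊆ F') : polyhedron F ⊆ polyhedron F' :=
  fun _ hx => ⟨hx.1, hx.2.imp fun _ hσ => ⟨h hσ.1, hσ.2⟩⟩

theorem depth_eq_zero_of_mem_polyhedron {L : Set (Finset ι)} {τ : Finset ι} (hτ : τ.Nonempty)
    {p x : ι → ℝ} (hL : IsLowerSet L) (hτL : τ ∉ L) (hp : ∀ v ∈ τ, 0 < p v)
    (hx : x ∈ polyhedron L) : depth hτ p x = 0 := by
  obtain ⟨hx, ρ, hρ, hxρ⟩ := hx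
  obtain ⟨v, hvτ, hvρ⟩ := not_subset.1 fun h => hτL (hL h hρ)
  refine le_antisymm ((inf'_le _ hvτ).trans_eq ?_) (depth_nonneg hτ hp hx.1)
  rw [hxρ v hvρ, zero_div]

theorem depth_lt_one {τ : Finset ι} (hτ : τ.Nonempty) {p x : ι → ℝ} (hp : p ∈ stdSimplex ℝ ι)
    (hp_pos : ∀ v ∈ τ, 0 < p v) (hp_zero : ∀ v ∉ τ, p v = 0) (hx : x ∈ stdSimplex ℝ ι)
    (hxp : x ≠ p) : depth hτ p x < 1 := by
  by_contra! h
  have hle : ∀ v ∈ univ, p v ≤ x v := fun v _ => by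
    by_cases hv : v ∈ τ
    · exact (le_mul_of_one_le_left (hp_pos v hv).le h).trans (depth_mul_le hτ hv (hp_pos v hv))
    · exact (hp_zero v hv).trans_le (hx.1 v)
  have heq := (sum_eq_sum_iff_of_le hle).1 (hp.2.trans hx.2.symm)
  exact hxp (funext fun v => (heq v (mem_univ v)).symm)

/-- The point `x - q • p`, rescaled so that the sum of its coordinates is `1`. If `p` has coordinate
sum `1`, this moves `x` along the ray from `p` through `x`; if `p` has coordinate sum `0`, this is a
translation. -/
noncomputable def pushAway (p : ι → ℝ) (q : ℝ) (x : ι → ℝ) : ι → ℝ :=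
  (1 - q * ∑ v, p v)⁻¹ • (x - q • p)

theorem pushAway_zero (p x : ι → ℝ) : pushAway p 0 x = x := by simp [pushAway]

theorem pushAway_mem_stdSimplex {p x : ι → ℝ} {q : ℝ} (hx : x ∈ stdSimplex ℝ ι)
    (hq : q * ∑ v, p v < 1) (hle : ∀ v, q * p v ≤ x v) : pushAway p q x ∈ stdSimplex ℝ ι := by
  have hpos : 0 < 1 - q * ∑ v, p v := sub_pos.2 hq
  refine ⟨fun v => mul_nonneg (inv_nonneg.2 hpos.le) (sub_nonneg.2 (hle v)), ?_⟩
  simp only [pushAway, Pi.smul_apply, Pi.sub_apply, smul_eq_mul, ← mul_sum, sum_sub_distrib, hx.2]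
  exact inv_mul_cancel₀ hpos.ne'

theorem pushAway_depth_mem_stdSimplex {τ : Finset ι} (hτ : τ.Nonempty) {p x : ι → ℝ}
    (hp_pos : ∀ v ∈ τ, 0 < p v) (hp_nonpos : ∀ v ∉ τ, p v ≤ 0) (hx : x ∈ stdSimplex ℝ ι)
    {t : ℝ} (ht0 : 0 ≤ t) (ht1 : t ≤ 1) (hsum : t * depth hτ p x * ∑ v, p v < 1) :
    pushAway p (t * depth hτ p x) x ∈ stdSimplex ℝ ι := by
  refine pushAway_mem_stdSimplex hx hsum fun v => ?_
  have hdepth : 0 ≤ depth hτ p x := depth_nonneg hτ hp_pos hx.1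
  by_cases hv : v ∈ τ
  · calc t * depth hτ p x * p v ≤ depth hτ p x * p v :=
          mul_le_mul_of_nonneg_right (mul_le_of_le_one_left hdepth ht1) (hp_pos v hv).le
      _ ≤ x v := depth_mul_le hτ hv (hp_pos v hv)
  · exact (mul_nonpos_of_nonneg_of_nonpos (mul_nonneg ht0 hdepth) (hp_nonpos v hv)).trans (hx.1 v)

section Push

variable [DecidableEq ι] {X : Type*} [TopologicalSpace X]

theorem nullhomotopic_of_push {L F : Set (Finset ι)} {τ σ : Finset ι} {p : ι → ℝ}
    (hL : IsLowerSet L) (hLF : L ⊆ F) (hσF : σ ∈ F) (hF : ∀ ρ ∈ F, ρ ∈ L ∨ ρ ⊆ σ)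
    (hτ : τ.Nonempty) (hτL : τ ∉ L) (hσL : ∀ v ∈ τ, σ.erase v ∈ L)
    (hp_pos : ∀ v ∈ τ, 0 < p v) (hp_nonpos : ∀ v ∉ τ, p v ≤ 0) (hp_zero : ∀ v ∉ σ, p v = 0)
    (hA : ∀ g : C(X, polyhedron L), g.Nullhomotopic) (f : C(X, polyhedron F))
    (hf : ∀ x, depth hτ p (f x) * ∑ v, p v < 1) : f.Nullhomotopic := by
  have hsum (t : unitInterval) (x : X) : t * depth hτ p (f x) * ∑ v, p v < 1 := by
    rw [mul_assoc]
    rcases le_total (depth hτ p (f x) * ∑ v, p v) 0 with h | h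
    · exact (mul_nonpos_of_nonneg_of_nonpos t.2.1 h).trans_lt one_pos
    · exact (mul_le_of_le_one_left h t.2.2).trans_lt (hf x)
  have hmem (t : unitInterval) (x : X) :
      pushAway p (t * depth hτ p (f x)) (f x) ∈ stdSimplex ℝ ι :=
    pushAway_depth_mem_stdSimplex hτ hp_pos hp_nonpos (f x).2.1 t.2.1 t.2.2 (hsum t x)
  have hcases (x : X) : (depth hτ p (f x) = 0 ∧ (f x).1 ∈ polyhedron L) ∨
      ∀ v ∉ σ, (f x).1 v = 0 := by
    obtain ⟨hx, ρ, hρ, hxρ⟩ := (f x).2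
    refine (hF ρ hρ).imp (fun hρL => ?_) fun hρσ v hv => hxρ v fun h => hv (hρσ h)
    have hxL : (f x).1 ∈ polyhedron L := ⟨hx, ρ, hρL, hxρ⟩
    exact ⟨depth_eq_zero_of_mem_polyhedron hτ hL hτL hp_pos hxL, hxL⟩
  have hcont := continuous_depth hτ p
  let H : C(unitInterval × X, ι → ℝ) :=
    ⟨fun z => pushAway p (z.1 * depth hτ p (f z.2)) (f z.2),
      .smul (.inv₀ (by fun_prop) fun z : unitInterval × X => (sub_pos.2 (hsum z.1 z.2)).ne')
        (by fun_prop)⟩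
  have hH (t : unitInterval) (x : X) : H (t, x) = pushAway p (t * depth hτ p (f x)) (f x) := rfl
  refine nullhomotopic_of_deformation (polyhedron_mono hLF) hA f H (fun ⟨t, x⟩ => ?_)
    (fun x => by simp [hH, pushAway_zero]) fun x => ?_
  · rcases hcases x with ⟨h, -⟩ | h
    · simp [hH, h, pushAway_zero]
    · exact ⟨hmem t x, σ, hσF, fun v hv => by simp [hH, pushAway, h v hv, hp_zero v hv]⟩
  · rcases hcases x with ⟨h, hxL⟩ | h
    · simpa [hH, h, pushAway_zero] using hxL
    · obtain ⟨v, hv, hxv⟩ := exists_depth_mul_eq hτ (x := (f x).1) hp_pos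
      refine ⟨hmem 1 x, σ.erase v, hσL v hv, fun w hw => ?_⟩
      rcases eq_or_ne w v with rfl | hwv
      · simp [hH, pushAway, hxv]
      · have hwσ : w ∉ σ := fun h => hw (mem_erase.2 ⟨hwv, h⟩)
        simp [hH, pushAway, h w hwσ, hp_zero w hwσ]

theorem nullhomotopic_of_collapse {L : Set (Finset ι)} {τ : Finset ι} {y : ι}
    (hL : IsLowerSet L) (hτ : τ.Nonempty) (hτL : τ ∉ L) (hy : y ∉ τ)
    (h : ∀ ρ ⊂ τ, insert y ρ ∈ L) (hA : ∀ g : C(X, polyhedron L), g.Nullhomotopic)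
    (f : C(X, polyhedron (L ∪ {τ, insert y τ}))) : f.Nullhomotopic := by
  let p : ι → ℝ := fun v => (if v ∈ τ then 1 else 0) - if v = y then (#τ : ℝ) else 0
  have hp_sum : ∑ v, p v = 0 := by simp [p]
  refine nullhomotopic_of_push (σ := insert y τ) (p := p) hL Set.subset_union_left (by simp) ?_ hτ
    hτL (fun v hv => ?_) (fun v hv => ?_) (fun v hv => ?_) (fun v hv => ?_) hA f
    (fun x => by rw [hp_sum, mul_zero]; exact one_pos)
  · rintro ρ (hρ | rfl | rfl)
    exacts [.inl hρ, .inr (subset_insert _ _), .inr subset_rfl]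
  · rw [erase_insert_of_ne (ne_of_mem_of_not_mem hv hy).symm]
    exact h _ (erase_ssubset hv)
  · simp [p, hv, ne_of_mem_of_not_mem hv hy]
  · by_cases hvy : v = y <;> simp [p, hv, hvy, hy]
  · obtain ⟨hvy, hvτ⟩ : v ≠ y ∧ v ∉ τ := by simpa using hv
    simp [p, hvy, hvτ]

theorem polyhedron_pair_empty_singleton (y : ι) : polyhedron {∅, {y}} = {Pi.single y 1} := by
  refine subset_antisymm ?_ (Set.singleton_subset_iff.2
    ⟨single_mem_stdSimplex ℝ y, {y}, by simp, fun v hv => by simp_all⟩)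
  rintro x ⟨hx, σ, hσ, hxσ⟩
  have hx_zero : ∀ v ≠ y, x v = 0 := fun v hv => hxσ v <| by rcases hσ with rfl | rfl <;> simp [hv]
  have hxy : x y = 1 := by rw [← hx.2, Fintype.sum_eq_single y hx_zero]
  refine funext fun v => ?_
  rcases eq_or_ne v y with rfl | hv
  · rw [hxy, Pi.single_eq_same]
  · rw [hx_zero v hv, Pi.single_eq_of_ne hv]

end Push

section Cell

open MeasureTheory Module

variable {E : Type*} [NormedAddCommGroup E] [NormedSpace ℝ E] [FiniteDimensional ℝ E]
  [MeasurableSpace E] [BorelSpace E] {μ : Measure E} [μ.IsAddHaarMeasure] {s : Set E}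

theorem exists_extend_sum_eq_zero [DecidableEq ι] {σ : Finset ι} {v₀ : ι} (hv₀ : v₀ ∈ σ) :
    ∃ e : (σ.erase v₀ → ℝ) →L[ℝ] ι → ℝ, ∀ d, (∀ w : σ.erase v₀, e d w = d w) ∧
      (∀ v ∉ σ, e d v = 0) ∧ ∑ v, e d v = 0 := by
  let e : (σ.erase v₀ → ℝ) →ₗ[ℝ] ι → ℝ := LinearMap.pi fun v =>
    if h : v ∈ σ.erase v₀ then LinearMap.proj ⟨v, h⟩
    else if v = v₀ then -∑ w, LinearMap.proj w else 0
  have he_mem (d) (w : σ.erase v₀) : e d w = d w := by simp [e, -mem_erase, w.2]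
  have he_self (d) : e d v₀ = -∑ w, d w := by simp [e, -univ_eq_attach]
  have he_notMem (d) : ∀ v ∉ σ, e d v = 0 := fun v hv => by
    simp [e, hv, (ne_of_mem_of_not_mem hv₀ hv).symm]
  refine ⟨e.toContinuousLinearMap, fun d => ⟨he_mem d, he_notMem d, ?_⟩⟩
  calc ∑ v, e d v = ∑ v ∈ σ, e d v :=
        (sum_subset (subset_univ σ) fun v _ => he_notMem d v).symm
    _ = -∑ w, d w + ∑ w : σ.erase v₀, e d w := by
        rw [← add_sum_erase σ _ hv₀, he_self, sum_coe_sort (σ.erase v₀) (e d)]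
    _ = 0 := by simp only [he_mem, neg_add_cancel]

theorem add_smul_mem_polyhedron {L : Set (Finset ι)} {σ : Finset ι} {p x d : ι → ℝ} {t : ℝ}
    (hL : IsLowerSet L) (hσ : σ.Nonempty) (hσL : σ ∉ L) (hp : ∀ v ∈ σ, 0 < p v)
    (hx : x ∈ polyhedron (insert σ L)) (hd : ∀ v ∈ σ, |d v| ≤ p v / 2) (hd_zero : ∀ v ∉ σ, d v = 0)
    (hd_sum : ∑ v, d v = 0) (ht0 : 0 ≤ t) (ht1 : t ≤ 1) :
    x + (t * min 1 (2 * depth hσ p x)) • d ∈ polyhedron (insert σ L) := by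
  have hdepth : 0 ≤ depth hσ p x := depth_nonneg _ hp hx.1.1
  obtain ⟨hx, ρ, rfl | hρ, hxρ⟩ := hx
  · have hstep : ∀ v ∈ ρ, |(t * min 1 (2 * depth hσ p x)) * d v| ≤ x v := fun v hv => by
      rw [abs_mul, abs_of_nonneg (mul_nonneg ht0 (le_min zero_le_one (by positivity)))]
      calc t * min 1 (2 * depth hσ p x) * |d v| ≤ 1 * (2 * depth hσ p x) * (p v / 2) := by
            gcongr
            exacts [min_le_right _ _, hd v hv]
        _ = depth hσ p x * p v := by ring
        _ ≤ x v := depth_mul_le _ hv (hp v hv)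
    have hzero : ∀ v ∉ ρ, (x + (t * min 1 (2 * depth hσ p x)) • d) v = 0 := fun v hv => by
      simp [hxρ v hv, hd_zero v hv]
    refine ⟨⟨fun v => ?_, ?_⟩, ρ, .inl rfl, hzero⟩
    · by_cases hv : v ∈ ρ
      · exact neg_le_iff_add_nonneg'.1 (abs_le.1 (hstep v hv)).1
      · exact (hzero v hv).ge
    · simp [sum_add_distrib, ← mul_sum, hd_sum, hx.2]
  · have hdepth_zero : depth hσ p x = 0 :=
      depth_eq_zero_of_mem_polyhedron _ hL hσL hp ⟨hx, ρ, hρ, hxρ⟩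
    simpa [hdepth_zero] using ⟨hx, ρ, .inr hρ, hxρ⟩

theorem exists_homotopic_forall_ne {L : Set (Finset ι)} {σ : Finset ι} {p : ι → ℝ}
    (hs : IsClosed s) (hμs : μ s = 0) (hL : IsLowerSet L) (hσ : σ.Nonempty) (hσL : σ ∉ L)
    (hcard : finrank ℝ E < #σ) (hp_pos : ∀ v ∈ σ, 0 < p v) (f : C(s, polyhedron (insert σ L))) :
    ∃ g : C(s, polyhedron (insert σ L)), f.Homotopic g ∧ ∀ x, (g x : ι → ℝ) ≠ p := by
  classical
  obtain ⟨v₀, hv₀⟩ := hσ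
  obtain ⟨e, he⟩ := exists_extend_sum_eq_zero hv₀
  obtain ⟨δ, hδ, hδe⟩ : ∃ δ > 0, ∀ d, ‖d‖ < δ → ∀ v ∈ σ, |e d v| < p v / 2 := by
    have hnear : ∀ᶠ d in nhds 0, ∀ v ∈ σ, |e d v| < p v / 2 := by
      refine (Finset.eventually_all σ).2 fun v hv => ?_
      have hev : Continuous fun d => |e d v| := by fun_prop
      exact hev.continuousAt.eventually_lt_const (by simp [hp_pos v hv])
    simpa [Metric.eventually_nhds_iff] using hnear
  let f₀ : C(s, σ.erase v₀ → ℝ) := ⟨fun x w => (f x : ι → ℝ) w,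
    continuous_pi fun w => (continuous_apply (w : ι)).comp (by fun_prop)⟩
  obtain ⟨g₀, hg₀, hg₀p⟩ := exists_dist_lt_forall_ne hs hμs
    (by rw [finrank_fintype_fun_eq_card, Fintype.card_coe, card_erase_of_mem hv₀]; omega)
    f₀ (fun w => p w) hδ
  let d : s → ι → ℝ := fun x => e (g₀ x - f₀ x)
  have hd (x : s) : ∀ v ∈ σ, |d x v| ≤ p v / 2 := fun v hv =>
    (hδe _ (by simpa [dist_eq_norm] using hg₀ x) v hv).le
  have hdepth := continuous_depth ⟨v₀, hv₀⟩ p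
  let H : C(unitInterval × s, ι → ℝ) :=
    ⟨fun z => f z.2 + (z.1 * min 1 (2 * depth ⟨v₀, hv₀⟩ p (f z.2))) • d z.2, by fun_prop⟩
  obtain ⟨g, hfg, hg⟩ := exists_homotopic_of_mem f H
    (fun ⟨t, x⟩ => add_smul_mem_polyhedron hL ⟨v₀, hv₀⟩ hσL hp_pos (f x).2 (hd x) (he _).2.1
      (he _).2.2 t.2.1 t.2.2) fun x => by simp [H]
  refine ⟨g, hfg, fun x hgx => hg₀p x (funext fun w => ?_)⟩
  have hfd : f x + d x = p := add_eq_of_add_smul_eq ⟨v₀, hv₀⟩ hp_pos (f x).2.1.1 (hd x) <| by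
    simpa [H] using (hg x).symm.trans hgx
  simpa [d, (he _).1 w, f₀] using congrFun hfd w

theorem nullhomotopic_of_cell {L : Set (Finset ι)} {σ : Finset ι} (hs : IsClosed s) (hμs : μ s = 0)
    (hL : IsLowerSet L) (hσL : σ ∉ L) (h : ∀ ρ ⊂ σ, ρ ∈ L) (hcard : finrank ℝ E < #σ)
    (hA : ∀ g : C(s, polyhedron L), g.Nullhomotopic) (f : C(s, polyhedron (insert σ L))) :
    f.Nullhomotopic := by
  classical
  have hσ : σ.Nonempty := card_pos.1 (by omega)
  let p : ι → ℝ := fun v => if v ∈ σ then (#σ : ℝ)⁻¹ else 0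
  have hp_pos : ∀ v ∈ σ, 0 < p v := fun v hv => by simp [p, hv, hσ.card_pos]
  have hp_zero : ∀ v ∉ σ, p v = 0 := fun v hv => by simp [p, hv]
  have hp : p ∈ stdSimplex ℝ ι := by
    refine ⟨fun v => ?_, by simp [p, hσ.card_ne_zero]⟩
    by_cases hv : v ∈ σ
    exacts [(hp_pos v hv).le, (hp_zero v hv).ge]
  obtain ⟨g, ⟨hfg⟩, hgp⟩ := exists_homotopic_forall_ne hs hμs hL hσ hσL hcard hp_pos f
  obtain ⟨b, ⟨hgb⟩⟩ : g.Nullhomotopic :=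
    nullhomotopic_of_push (σ := σ) hL (Set.subset_insert _ _) (Set.mem_insert _ _)
      (fun ρ hρ => hρ.symm.imp_right fun h => h.subset) hσ hσL (fun v hv => h _ (erase_ssubset hv))
      hp_pos (fun v hv => (hp_zero v hv).le) hp_zero hA g
      fun x => by
        rw [hp.2, mul_one]
        exact depth_lt_one hσ hp hp_pos hp_zero (g x).2.1 (hgp x)
  exact ⟨b, ⟨hfg.trans hgb⟩⟩

end Cell

end Polyhedron

section MorseBuilt

variable {X : Type*} [DecidableEq X]

/-- Families of finite sets that arise from the void family by adding successively pairs
`{τ, insert x τ}` in which `τ` is a free face of `insert x τ` (elementary expansions), and single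
sets with at least `n + 2` elements all of whose proper subsets are already present (cells of
dimension greater than `n`). -/
inductive MorseBuilt (n : ℤ) : Set (Finset X) → Prop
  | empty : MorseBuilt n ∅
  | expand {L : Set (Finset X)} {τ : Finset X} {x : X} (hL : MorseBuilt n L) (hτ : τ ∉ L)
      (hx : x ∉ τ) (h : ∀ ρ ⊂ τ, insert x ρ ∈ L) : MorseBuilt n (L ∪ {τ, insert x τ})
  | cell {L : Set (Finset X)} {σ : Finset X} (hL : MorseBuilt n L) (hσ : σ ∉ L)
      (h : ∀ ρ ⊂ σ, ρ ∈ L) (hn : n + 2 ≤ #σ) : MorseBuilt n (insert σ L)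

theorem insert_injOn_notMem (x : X) : Set.InjOn (insert x) {σ : Finset X | x ∉ σ} :=
  fun σ hσ τ hτ h => by rw [← erase_insert hσ, h, erase_insert hτ]

theorem eq_deletion_union_image_link (x : X) (F : Set (Finset X)) :
    F = {σ ∈ F | x ∉ σ} ∪ insert x '' {σ | x ∉ σ ∧ insert x σ ∈ F} := by
  ext σ
  constructor
  · intro hσ
    by_cases hx : x ∈ σ
    · exact .inr ⟨σ.erase x, ⟨notMem_erase _ _, by rwa [insert_erase hx]⟩, insert_erase hx⟩
    · exact .inl ⟨hσ, hx⟩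
  · rintro (h | ⟨τ, h, rfl⟩)
    exacts [h.1, h.2]

namespace MorseBuilt

variable {m n : ℤ} {x : X} {D F L : Set (Finset X)}

theorem mono (hmn : m ≤ n) (h : MorseBuilt n F) : MorseBuilt m F := by
  induction h with
  | empty => exact .empty
  | expand _ hτ hx h ih => exact .expand ih hτ hx h
  | cell _ hσ h hn ih => exact .cell ih hσ h (by omega)

theorem isLowerSet (h : MorseBuilt n F) : IsLowerSet F := by
  induction h with
  | empty => exact isLowerSet_empty
  | @expand L τ x _ hτ hx h ih =>
    have hproper : ∀ ρ ⊂ insert x τ, ρ ∈ L ∪ {τ, insert x τ} := fun ρ hρ => by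
      rcases eq_or_ne (ρ.erase x) τ with hρτ | hρτ
      · have hxρ : x ∉ ρ := fun hxρ => hρ.ne (by rw [← hρτ, insert_erase hxρ])
        exact .inr (.inl (by rw [← hρτ, erase_eq_of_notMem hxρ]))
      · have hρx : ρ ⊆ insert x (ρ.erase x) := subset_insert_iff.2 subset_rfl
        exact .inl (ih hρx (h _ ((subset_insert_iff.1 hρ.subset).ssubset_of_ne hρτ)))
    rintro σ ρ (hρσ : ρ ⊆ σ) (hσ | rfl | rfl)
    · exact .inl (ih hρσ hσ)
    · exact hproper _ (hρσ.trans_ssubset (ssubset_insert hx))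
    · rcases hρσ.eq_or_ssubset with rfl | hρσ
      exacts [.inr (.inr rfl), hproper _ hρσ]
  | @cell L σ₀ _ hσ₀ h hn ih =>
    rintro σ ρ (hρσ : ρ ⊆ σ) (rfl | hσ)
    · exact hρσ.eq_or_ssubset.imp id (h ρ)
    · exact .inr (ih hρσ hσ)

theorem union_image_insert (hD : MorseBuilt n D) (hxD : ∀ σ ∈ D, x ∉ σ)
    (hL : MorseBuilt (n - 1) L) (hLD : L ⊆ D) : MorseBuilt n (D ∪ insert x '' L) := by
  have insert_mem_iff {L : Set (Finset X)} {τ : Finset X} (hLD : L ⊆ D) (hτ : τ ∈ D) :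
      insert x τ ∈ D ∪ insert x '' L ↔ τ ∈ L := by
    refine ⟨?_, fun h => .inr ⟨τ, h, rfl⟩⟩
    rintro (h | ⟨σ, hσ, h⟩)
    · exact absurd (mem_insert_self x τ) (hxD _ h)
    · rwa [← insert_injOn_notMem x (hxD _ (hLD hσ)) (hxD _ hτ) h]
  have erase_ssubset_of {ρ τ : Finset X} (hρ : ρ ⊂ insert x τ) (hxρ : x ∈ ρ) : ρ.erase x ⊂ τ :=
    (subset_insert_iff.1 hρ.subset).ssubset_of_ne fun h => hρ.ne (by rw [← h, insert_erase hxρ])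
  have subset_of {ρ τ : Finset X} (hρ : ρ ⊂ insert x τ) (hxρ : x ∉ ρ) : ρ ⊆ τ :=
    (subset_insert_iff_of_notMem hxρ).1 hρ.subset
  induction hL with
  | empty => simpa using hD
  | @expand L τ y _ hτ hy h ih =>
    have hyD : insert y τ ∈ D := hLD (by simp)
    have hLD : L ⊆ D := Set.subset_union_left.trans hLD
    have hyx : y ≠ x := fun e => hxD _ hyD (by simp [e])
    convert expand (ih hLD) (τ := insert x τ) (x := y)
      (mt (insert_mem_iff hLD (hD.isLowerSet (subset_insert y τ) hyD)).1 hτ) (by simp [hyx, hy])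
      fun ρ hρ => ?_ using 1
    · rw [Set.image_union, Set.image_pair, Finset.insert_comm x y, Set.union_assoc]
    · by_cases hxρ : x ∈ ρ
      · refine .inr ⟨_, h _ (erase_ssubset_of hρ hxρ), ?_⟩
        rw [Finset.insert_comm, insert_erase hxρ]
      · exact .inl (hD.isLowerSet (insert_subset_insert y (subset_of hρ hxρ)) hyD)
  | @cell L σ _ hσ h hn ih =>
    have hσD : σ ∈ D := hLD (by simp)
    have hLD : L ⊆ D := (Set.subset_insert _ _).trans hLD
    convert cell (ih hLD) (mt (insert_mem_iff hLD hσD).1 hσ) (fun ρ hρ => ?_) ?_ using 1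
    · rw [Set.image_insert_eq, Set.union_insert]
    · by_cases hxρ : x ∈ ρ
      · exact .inr ⟨_, h _ (erase_ssubset_of hρ hxρ), insert_erase hxρ⟩
      · exact .inl (hD.isLowerSet (subset_of hρ hxρ) hσD)
    · rw [card_insert_of_notMem (hxD _ hσD)]
      push_cast
      omega

theorem union_image_insert_self (n : ℤ) (hD : IsLowerSet D) (hDfin : D.Finite)
    (hxD : ∀ σ ∈ D, x ∉ σ) : MorseBuilt n (D ∪ insert x '' D) := by
  induction hN : D.ncard generalizing D with
  | zero =>
    obtain rfl := (Set.ncard_eq_zero hDfin).1 hN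
    simpa using empty
  | succ N ih =>
    obtain ⟨τ, hτ⟩ := hDfin.exists_maximal ((Set.ncard_pos hDfin).1 (by omega))
    have hD' : MorseBuilt n (D \ {τ} ∪ insert x '' (D \ {τ})) :=
      ih (hD.erase fun σ hσ h => (hτ.eq_of_le hσ h).symm) hDfin.sdiff
        (fun σ hσ => hxD σ hσ.1) (by rw [Set.ncard_sdiff_singleton_of_mem hτ.prop, hN]; rfl)
    convert hD'.expand (τ := τ) (x := x) ?_ (hxD τ hτ.prop) fun ρ hρ =>
      .inr ⟨ρ, ⟨hD hρ.subset hτ.prop, hρ.ne⟩, rfl⟩ using 1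
    · conv_lhs => rw [← Set.insert_sdiff_self_of_mem hτ.prop, Set.image_insert_eq]
      rw [Set.insert_union, Set.union_insert, Set.union_insert, Set.union_singleton,
        Set.insert_comm]
    · rintro (h | ⟨σ, -, h⟩)
      exacts [h.2 rfl, hxD τ hτ.prop (h ▸ mem_insert_self x σ)]

theorem of_deletion_link (hF : IsLowerSet F) (hdel : MorseBuilt n {σ ∈ F | x ∉ σ})
    (hlink : MorseBuilt (n - 1) {σ | x ∉ σ ∧ insert x σ ∈ F}) : MorseBuilt n F := by
  rw [eq_deletion_union_image_link x F]
  exact hdel.union_image_insert (fun σ hσ => hσ.2) hlink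
    fun σ hσ => ⟨hF (subset_insert x σ) hσ.2, hσ.1⟩

theorem of_cone (n : ℤ) (hF : IsLowerSet F) (hFfin : F.Finite) (hx : ∀ σ ∈ F, insert x σ ∈ F) :
    MorseBuilt n F := by
  have hlink : {σ | x ∉ σ ∧ insert x σ ∈ F} = {σ ∈ F | x ∉ σ} :=
    Set.ext fun σ => ⟨fun h => ⟨hF (subset_insert x σ) h.2, h.1⟩, fun h => ⟨h.2, hx σ h.1⟩⟩
  rw [eq_deletion_union_image_link x F, hlink]
  exact union_image_insert_self n (fun σ ρ h hσ => ⟨hF h hσ.1, fun hxρ => hσ.2 (h hxρ)⟩)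
    (hFfin.subset fun σ hσ => hσ.1) fun σ hσ => hσ.2

theorem nullhomotopic [Fintype X] (hF : MorseBuilt n F) (hne : F.Nonempty) {j : ℕ} (hj : j ≤ n + 1)
    (f : C(Metric.sphere (0 : EuclideanSpace ℝ (Fin j)) 1, polyhedron F)) : f.Nullhomotopic := by
  induction hF with
  | empty => exact absurd hne Set.not_nonempty_empty
  | @expand L τ y hL hτ hy h ih =>
    rcases τ.eq_empty_or_nonempty with rfl | hτne
    · have hLempty : L = ∅ := Set.eq_empty_of_forall_notMem fun σ hσ =>
        hτ (hL.isLowerSet (empty_subset σ) hσ)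
      have hpoint : polyhedron (L ∪ {∅, insert y ∅}) = {Pi.single y 1} := by
        rw [hLempty, Set.empty_union, insert_empty_eq, polyhedron_pair_empty_singleton]
      have hunique : Unique (polyhedron (L ∪ {∅, insert y ∅})) := by
        rw [hpoint]; infer_instance
      exact ⟨default, by rw [Subsingleton.elim f (.const _ default)]⟩
    · exact nullhomotopic_of_collapse hL.isLowerSet hτne hτ hy h
        (ih ⟨_, h _ hτne.empty_ssubset⟩) f
  | @cell L σ hL hσ h hn ih =>
    exact nullhomotopic_of_cell (μ := MeasureTheory.volume) Metric.isClosed_sphere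
      (MeasureTheory.Measure.addHaar_sphere_of_ne_zero _ _ one_ne_zero) hL.isLowerSet hσ h
      (by rw [finrank_euclideanSpace_fin]; omega)
      (ih ⟨∅, h _ (card_pos.1 (by omega)).empty_ssubset⟩) f

theorem isNConnected [Fintype X] (hF : MorseBuilt n F) (hne : F.Nonempty) :
    IsNConnected n (polyhedron F) :=
  fun _ hj f => exists_closedBall_extension_of_nullhomotopic (hF.nullhomotopic hne hj f)

end MorseBuilt

end MorseBuilt

section IndependentMatchings

open scoped Matroid

variable {X E V : Type*} {a : X → E} {b : X → V} {M : Matroid E} {A A' : Set X} {e : E} {n : ℤ}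

/-- The neighbours of `e` in the bipartite multigraph between `E` and `V` with edge set `A`, where
the edge `x` joins `a x` to `b x`. -/
def nbrs (a : X → E) (b : X → V) (A : Set X) (e : E) : Set V :=
  b '' (A ∩ a ⁻¹' {e})

/-- Every element of `S` has more than twice as many neighbours as there are other elements of `S`
that share a neighbour with it. -/
def HasManyNbrs (a : X → E) (b : X → V) (A : Set X) (S : Set E) : Prop :=
  ∀ e ∈ S, 2 * {e' ∈ S \ {e} | ¬Disjoint (nbrs a b A e') (nbrs a b A e)}.ncard <
    (nbrs a b A e).ncard

/-- The matchings in the bipartite multigraph between `E` and `V` with edge set `A` whose set of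
ends in `E` is independent in `M`. -/
def independentMatchings (a : X → E) (b : X → V) (M : Matroid E) (A : Set X) : Set (Finset X) :=
  {σ | ↑σ ⊆ A ∧ Set.InjOn b σ ∧ (M.comap a).Indep σ}

theorem mem_nbrs {x : X} (hx : x ∈ A) : b x ∈ nbrs a b A (a x) :=
  ⟨x, ⟨hx, rfl⟩, rfl⟩

theorem nbrs_mono (h : A' ⊆ A) : nbrs a b A' e ⊆ nbrs a b A e :=
  Set.image_mono (Set.inter_subset_inter_left _ h)

theorem HasManyNbrs.mono [Finite E] {S S' : Set E} (h : HasManyNbrs a b A S) (hS : S' ⊆ S) :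
    HasManyNbrs a b A S' := fun e he => by
  have hconflict : {e' ∈ S' \ {e} | ¬Disjoint (nbrs a b A e') (nbrs a b A e)} ⊆
      {e' ∈ S \ {e} | ¬Disjoint (nbrs a b A e') (nbrs a b A e)} :=
    fun e' he' => ⟨⟨hS he'.1.1, he'.1.2⟩, he'.2⟩
  have := Set.ncard_le_ncard hconflict
  have := h e (hS he)
  omega

theorem HasManyNbrs.sdiff_singleton [Finite X] [Finite E] {S : Set E} {Z : Set V}
    (h : HasManyNbrs a b A S) (he : e ∈ S) (hA' : A' ⊆ A) (hZ : Z ⊆ nbrs a b A e)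
    (hZcard : Z.ncard ≤ 2) (hdiff : ∀ x ∈ A, a x ≠ e → x ∈ A' ∨ b x ∈ Z) :
    HasManyNbrs a b A' (S \ {e}) := by
  rintro e' ⟨he', hne⟩
  have hconflict : {e'' ∈ (S \ {e}) \ {e'} | ¬Disjoint (nbrs a b A' e'') (nbrs a b A' e')} ⊆
      {e'' ∈ S \ {e'} | ¬Disjoint (nbrs a b A e'') (nbrs a b A e')} \ {e} :=
    fun e'' h'' => ⟨⟨⟨h''.1.1.1, h''.1.2⟩, fun hd =>
      h''.2 (hd.mono (nbrs_mono hA') (nbrs_mono hA'))⟩, h''.1.1.2⟩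
  have hlost : nbrs a b A e' \ Z ⊆ nbrs a b A' e' := by
    rintro _ ⟨⟨x, ⟨hx, rfl⟩, rfl⟩, hxZ⟩
    exact mem_nbrs ((hdiff x hx hne).resolve_right hxZ)
  have hconflict_card := Set.ncard_le_ncard hconflict
  have hlost_card := Set.ncard_le_ncard hlost (Set.toFinite (b '' _))
  by_cases hdisj : Disjoint (nbrs a b A e') Z
  · have hconflict_le := (Set.ncard_sdiff_singleton_le _ _).trans' hconflict_card
    rw [hdisj.sdiff_eq_left] at hlost_card
    have := h e' he'
    omega
  · have hmem : e ∈ {e'' ∈ S \ {e'} | ¬Disjoint (nbrs a b A e'') (nbrs a b A e')} :=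
      ⟨⟨he, Ne.symm hne⟩, fun hd => hdisj (hd.symm.mono_right hZ)⟩
    rw [Set.ncard_sdiff_singleton_of_mem hmem] at hconflict_card
    have hpos := (Set.ncard_pos).2 ⟨e, hmem⟩
    have hle := Set.ncard_le_ncard_sdiff_add_ncard (nbrs a b A e') Z
      ((Set.toFinite (b '' _)).subset hZ)
    have := h e' he'
    omega

theorem empty_mem_independentMatchings : ∅ ∈ independentMatchings a b M A := by
  simp [independentMatchings]

theorem isLowerSet_independentMatchings : IsLowerSet (independentMatchings a b M A) :=
  fun _ _ h hσ => ⟨(coe_subset.2 h).trans hσ.1, hσ.2.1.mono (coe_subset.2 h),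
    hσ.2.2.subset (coe_subset.2 h)⟩

theorem deletion_independentMatchings (x : X) :
    {σ ∈ independentMatchings a b M A | x ∉ σ} = independentMatchings a b M (A \ {x}) := by
  ext σ
  simp only [independentMatchings, Set.mem_ofPred_eq, Set.subset_sdiff,
    Set.disjoint_singleton_right, mem_coe]
  tauto

theorem independentMatchings_delete :
    independentMatchings a b (M ＼ {e}) A = independentMatchings a b M (A \ a ⁻¹' {e}) := by
  ext σ
  simp only [independentMatchings, Set.mem_ofPred_eq, Set.subset_sdiff, Matroid.comap_indep_iff,
    Matroid.delete_indep_iff, Set.disjoint_image_left]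
  tauto

section Link

variable [DecidableEq X] {x : X}

theorem link_independentMatchings (hx : x ∈ A) (hloop : M.IsNonloop (a x)) :
    {σ | x ∉ σ ∧ insert x σ ∈ independentMatchings a b M A} =
      independentMatchings a b (M ／ {a x}) {y ∈ A | b y ≠ b x} := by
  ext σ
  simp only [independentMatchings, Set.mem_ofPred_eq, Matroid.comap_indep_iff, coe_insert,
    (Matroid.indep_singleton.2 hloop).contract_indep_iff, Set.image_insert_eq,
    Set.union_singleton, Set.disjoint_singleton_right, Set.insert_subset_iff]
  have hsub : ↑σ ⊆ {y ∈ A | b y ≠ b x} ↔ ↑σ ⊆ A ∧ b x ∉ b '' σ := by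
    simp [Set.subset_def]
    grind
  rw [hsub]
  constructor
  · rintro ⟨hxσ, hA, hb, hM, ha⟩
    rw [Set.injOn_insert (mem_coe.not.2 hxσ)] at ha hb
    exact ⟨⟨hA.2, hb.2⟩, hb.1, ⟨ha.2, hM⟩, ha.1⟩
  · rintro ⟨⟨hA, hbx⟩, hb, ⟨hax, hM⟩, ha⟩
    have hxσ : x ∉ (σ : Set X) := fun h => hbx ⟨x, h, rfl⟩
    rw [Set.injOn_insert hxσ, Set.injOn_insert hxσ]
    exact ⟨hxσ, ⟨hx, hA⟩, ⟨hb, hbx⟩, hM, ha, hax⟩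

theorem insert_mem_of_isColoop {σ : Finset X} (hloop : M.IsColoop (a x)) (hx : x ∈ A)
    (ha : ∀ y ∈ A, a y = a x → y = x) (hb : ∀ y ∈ A, b y = b x → y = x)
    (hσ : σ ∈ independentMatchings a b M A) : insert x σ ∈ independentMatchings a b M A := by
  by_cases hxσ : x ∈ σ
  · rwa [insert_eq_of_mem hxσ]
  obtain ⟨hσA, hbσ, hM, haσ⟩ := hσ
  have hax : a x ∉ a '' σ := fun ⟨y, hy, h⟩ => hxσ (ha y (hσA hy) h ▸ hy)
  have hbx : b x ∉ b '' σ := fun ⟨y, hy, h⟩ => hxσ (hb y (hσA hy) h ▸ hy)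
  refine ⟨?_, ?_, ?_, ?_⟩ <;> rw [coe_insert]
  · exact Set.insert_subset hx hσA
  · exact (Set.injOn_insert (mem_coe.not.2 hxσ)).2 ⟨hbσ, hbx⟩
  · rw [Set.image_insert_eq]
    exact hloop.insert_indep_of_indep hM
  · exact (Set.injOn_insert (mem_coe.not.2 hxσ)).2 ⟨haσ, hax⟩

theorem isNonloop_of_insert_mem {σ : Finset X} (h : insert x σ ∈ independentMatchings a b M A) :
    M.IsNonloop (a x) :=
  Matroid.indep_singleton.1 (h.2.2.1.subset (by simp))

theorem exists_isBase_contract [Finite E] (he : M.IsNonloop e) {B : Set E} (hB : M.IsBase B) :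
    ∃ B', (M ／ {e}).IsBase B' ∧ B'.ncard + 1 = B.ncard := by
  have he' := Matroid.indep_singleton.2 he
  obtain ⟨B₁, hB₁, heB₁⟩ := he'.exists_isBase_superset
  rw [Set.singleton_subset_iff] at heB₁
  refine ⟨B₁ \ {e}, he'.contract_isBase_iff.2 ⟨?_, Set.disjoint_sdiff_left⟩, ?_⟩
  · rwa [Set.sdiff_union_of_subset (Set.singleton_subset_iff.2 heB₁)]
  · rw [Set.ncard_sdiff_singleton_add_one heB₁, hB₁.ncard_eq_ncard_of_isBase hB]

namespace MorseBuilt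

theorem independentMatchings_of_diff {D : Set X} (hD : D.Finite)
    (hdel : MorseBuilt n (independentMatchings a b M (A \ D)))
    (hlink : ∀ x ∈ A ∩ D, M.IsNonloop (a x) → ∀ A', A \ D ⊆ A' → A' ⊆ A →
      MorseBuilt (n - 1) (independentMatchings a b (M ／ {a x}) {y ∈ A' | b y ≠ b x})) :
    MorseBuilt n (independentMatchings a b M A) := by
  induction D, hD using Set.Finite.induction_on generalizing A with
  | empty => simpa using hdel
  | @insert x D _ _ ih =>
    rw [Set.insert_eq, ← Set.sdiff_sdiff] at hdel hlink
    have hrest : MorseBuilt n (independentMatchings a b M (A \ {x})) :=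
      ih hdel fun y hy hloop A' hDA' hA' => hlink y ⟨hy.1.1, .inr hy.2⟩ hloop A' hDA'
        (hA'.trans Set.sdiff_subset)
    by_cases hxA : x ∈ A
    · refine of_deletion_link (x := x) isLowerSet_independentMatchings
        (by rwa [deletion_independentMatchings]) ?_
      by_cases hloop : M.IsNonloop (a x)
      · rw [link_independentMatchings hxA hloop]
        exact hlink x ⟨hxA, .inl rfl⟩ hloop A (Set.sdiff_subset.trans Set.sdiff_subset) subset_rfl
      · have hempty : {σ | x ∉ σ ∧ insert x σ ∈ independentMatchings a b M A} = ∅ :=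
          Set.eq_empty_of_forall_notMem fun σ hσ => hloop (isNonloop_of_insert_mem hσ.2)
        exact hempty ▸ .empty
    · rwa [Set.sdiff_singleton_eq_self hxA] at hrest

variable [Finite X] [Finite E]

theorem independentMatchings_of_delete (hA : HasManyNbrs a b A M.E) (he : e ∈ M.E)
    (hdel : MorseBuilt n (independentMatchings a b (M ＼ {e}) A))
    (hcontr : M.IsNonloop e → ∀ A', HasManyNbrs a b A' (M.E \ {e}) →
      MorseBuilt (n - 1) (independentMatchings a b (M ／ {e}) A')) :
    MorseBuilt n (independentMatchings a b M A) := by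
  refine independentMatchings_of_diff (Set.toFinite (a ⁻¹' {e}))
    (by rwa [← independentMatchings_delete]) ?_
  rintro x ⟨hxA, rfl⟩ hloop A' hDA' hA'
  refine hcontr hloop _ (hA.sdiff_singleton (Z := {b x}) he (fun y hy => hA' hy.1)
    (Set.singleton_subset_iff.2 (mem_nbrs hxA)) (by simp) fun y hy hyx => ?_)
  by_cases hby : b y = b x
  exacts [.inr hby, .inl ⟨hDA' ⟨hy, hyx⟩, hby⟩]

theorem independentMatchings_of_isColoop (hA : HasManyNbrs a b A M.E) (he : M.IsColoop e)
    (hcontr : ∀ e', M.IsNonloop e' → ∀ A', HasManyNbrs a b A' (M.E \ {e'}) →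
      MorseBuilt (n - 1) (independentMatchings a b (M ／ {e'}) A')) :
    MorseBuilt n (independentMatchings a b M A) := by
  obtain ⟨_, x₀, ⟨hx₀, rfl⟩, rfl⟩ : (nbrs a b A e).Nonempty :=
    Set.nonempty_of_ncard_ne_zero (by have := hA e he.mem_ground; omega)
  -- Discard the other edges at `b x₀`, then the other edges at `a x₀`: `x₀` is now isolated.
  refine independentMatchings_of_diff (Set.toFinite {x | b x = b x₀ ∧ a x ≠ a x₀}) ?_ ?_
  · refine independentMatchings_of_diff (Set.toFinite {x | a x = a x₀ ∧ x ≠ x₀}) ?_ ?_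
    · refine of_cone (x := x₀) n isLowerSet_independentMatchings (Set.toFinite _) fun σ hσ => ?_
      have ha : ∀ x ∈ (A \ {x | b x = b x₀ ∧ a x ≠ a x₀}) \ {x | a x = a x₀ ∧ x ≠ x₀},
          a x = a x₀ → x = x₀ := fun x hx h => by_contra fun hne => hx.2 ⟨h, hne⟩
      exact insert_mem_of_isColoop he ⟨⟨hx₀, fun h => h.2 rfl⟩, fun h => h.2 rfl⟩ ha
        (fun x hx h => ha x hx (by_contra fun hne => hx.1.2 ⟨h, hne⟩)) hσ
    · rintro x ⟨⟨hxA, -⟩, hx, -⟩ hloop A' hDA' hA'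
      refine hcontr _ hloop _ (hA.sdiff_singleton (Z := {b x₀, b x}) hloop.mem_ground
        (fun y hy => (hA' hy.1).1) (Set.pair_subset (hx ▸ mem_nbrs hx₀) (mem_nbrs hxA))
        ((Set.ncard_insert_le _ _).trans (by simp)) fun y hy hyx => ?_)
      by_cases hby : b y ∈ ({b x₀, b x} : Set V)
      · exact .inr hby
      · simp only [Set.mem_insert_iff, Set.mem_singleton_iff, not_or] at hby
        exact .inl ⟨hDA' ⟨⟨hy, fun h => hby.1 h.1⟩, fun h => hyx (h.1.trans hx.symm)⟩, hby.2⟩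
  · rintro x ⟨hxA, hx, -⟩ hloop A' hDA' hA'
    refine hcontr _ hloop _ (hA.sdiff_singleton (Z := {b x}) hloop.mem_ground
      (fun y hy => hA' hy.1) (Set.singleton_subset_iff.2 (mem_nbrs hxA)) (by simp) fun y hy _ => ?_)
    by_cases hby : b y = b x
    exacts [.inr hby, .inl ⟨hDA' ⟨hy, fun h => hby (h.1.trans hx.symm)⟩, hby⟩]

theorem independentMatchings_of_isBase {B : Set E} (hB : M.IsBase B)
    (hA : HasManyNbrs a b A M.E) :
    MorseBuilt (B.ncard - 2) (independentMatchings a b M A) := by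
  induction hN : M.E.ncard generalizing M A B with
  | zero =>
    have hE : M.E = ∅ := (Set.ncard_eq_zero).1 hN
    have hempty : independentMatchings a b M A = insert ∅ ∅ :=
      Set.ext fun σ => ⟨fun hσ => .inl (by simpa [hE] using hσ.2.2.1.subset_ground),
        by rintro (rfl | h); exacts [empty_mem_independentMatchings, h.elim]⟩
    have hBempty : B = ∅ := Set.subset_empty_iff.1 (hE ▸ hB.subset_ground)
    rw [hempty, hBempty]
    exact .cell .empty (Set.notMem_empty _) (fun ρ h => absurd h (not_ssubset_empty ρ)) (by simp)
  | succ N ih =>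
    have hcard {e : E} (he : e ∈ M.E) : (M.E \ {e}).ncard = N := by
      rw [Set.ncard_sdiff_singleton_of_mem he, hN]; rfl
    have hcontr (e : E) (he : M.IsNonloop e) (A' : Set X) (hA' : HasManyNbrs a b A' (M.E \ {e})) :
        MorseBuilt (B.ncard - 2 - 1) (independentMatchings a b (M ／ {e}) A') := by
      obtain ⟨B', hB', hB'card⟩ := exists_isBase_contract he hB
      exact (ih hB' hA' (hcard he.mem_ground)).mono (by omega)
    obtain ⟨e, he⟩ : M.E.Nonempty := Set.nonempty_of_ncard_ne_zero (by omega)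
    by_cases hcoloop : M.IsColoop e
    · exact independentMatchings_of_isColoop hA hcoloop hcontr
    · simp only [Matroid.isColoop_iff_forall_mem_isBase, not_forall] at hcoloop
      obtain ⟨B', hB', heB'⟩ := hcoloop
      have hdel : (M ＼ {e}).IsBase B' := Matroid.delete_isBase_iff.2
        (hB'.isBasis_of_subset Set.sdiff_subset (Set.subset_sdiff_singleton hB'.subset_ground heB'))
      rw [hB.ncard_eq_ncard_of_isBase hB'] at hcontr ⊢
      exact independentMatchings_of_delete hA he (ih hdel (hA.mono Set.sdiff_subset) (hcard he))
        (hcontr e)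

theorem independentMatchings_of_indep {I : Set E} (hI : M.Indep I)
    (hA : HasManyNbrs a b A M.E) :
    MorseBuilt (I.ncard - 2) (independentMatchings a b M A) := by
  obtain ⟨B, hB, hIB⟩ := hI.exists_isBase_superset
  have := Set.ncard_le_ncard hIB
  exact (independentMatchings_of_isBase hB hA).mono (by omega)

end MorseBuilt

end Link

end IndependentMatchings

section FullRows

open scoped Matroid

/-- The uniform matroid on `α` whose independent sets have at most `m` elements. -/
def uniformMatroid (α : Type*) [Finite α] (m : ℕ) : Matroid α :=
  (IndepMatroid.ofFinite Set.finite_univ (fun I => I.ncard ≤ m) (by simp)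
    (fun I J hJ hIJ => (Set.ncard_le_ncard hIJ).trans hJ)
    (fun I J _ hJ hIJ => by
      obtain ⟨e, heJ, heI⟩ := Set.exists_mem_notMem_of_ncard_lt_ncard hIJ
      exact ⟨e, heJ, heI, by rw [Set.ncard_insert_of_notMem heI]; omega⟩)
    fun I _ => Set.subset_univ I).matroid

theorem eRk_uniformMatroid {α : Type*} [Finite α] (m : ℕ) (S : Set α) :
    (uniformMatroid α m).eRk S = min m S.ncard := by
  refine le_antisymm ?_ ?_
  · obtain ⟨I, hI⟩ := (uniformMatroid α m).exists_isBasis' S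
    rw [← hI.encard_eq_eRk, ← I.toFinite.cast_ncard_eq]
    exact_mod_cast le_min hI.indep (Set.ncard_le_ncard hI.subset)
  · obtain ⟨I, hIS, hI⟩ := Set.exists_subset_card_eq (min_le_right m S.ncard)
    have hindep : (uniformMatroid α m).Indep I := hI.trans_le (min_le_left _ _)
    calc ((min m S.ncard : ℕ) : ℕ∞) = I.encard := by rw [← hI, I.toFinite.cast_ncard_eq]
      _ ≤ _ := hindep.encard_le_eRk_of_subset hIS

/-- The matroid on `ρ × κ` in which a set is independent if it contains at most `s` of the rows
`{i} × κ`, that is, if its complement meets at least `|ρ| - s` rows. -/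
noncomputable def fullRowMatroid (ρ κ : Type*) [Finite ρ] (s : ℕ) : Matroid (ρ × κ) :=
  ((uniformMatroid ρ (Nat.card ρ - s)).comap Prod.fst)✶

variable {ρ κ : Type*} [Finite ρ] [Nonempty κ] {s : ℕ}

theorem fullRowMatroid_indep_iff {T : Set (ρ × κ)} :
    (fullRowMatroid ρ κ s).Indep T ↔ {i | ∀ j, (i, j) ∈ T}.ncard ≤ s := by
  set N : Matroid (ρ × κ) := (uniformMatroid ρ (Nat.card ρ - s)).comap Prod.fst
  have hrank (S : Set (ρ × κ)) : N.eRk S = min (Nat.card ρ - s) (Prod.fst '' S).ncard := by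
    rw [Matroid.eRk_comap, eRk_uniformMatroid]
  have hmeets : Prod.fst '' Tᶜ = {i | ∀ j, (i, j) ∈ T}ᶜ := by
    ext i
    simp
  have hcompl := Set.ncard_add_ncard_compl {i | ∀ j, (i, j) ∈ T}
  calc N.Coindep T ↔ N.Spanning Tᶜ := by
        rw [Matroid.coindep_iff_compl_spanning (Set.subset_univ T), Set.compl_eq_univ_sdiff]; rfl
    _ ↔ N.eRk Set.univ ≤ N.eRk Tᶜ := by
        rw [Matroid.spanning_iff_eRk_le (Set.subset_univ _), Matroid.eRank_def]; rfl
    _ ↔ _ := by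
        rw [hrank, hrank, Set.image_univ_of_surjective Prod.fst_surjective, hmeets, Set.ncard_univ]
        norm_cast
        omega

theorem exists_fullRowMatroid_indep_ncard_eq [Finite κ] (hs : s ≤ Nat.card ρ) :
    ∃ I, (fullRowMatroid ρ κ s).Indep I ∧ I.ncard = Nat.card ρ * (Nat.card κ - 1) + s := by
  obtain ⟨R, -, hR⟩ := Set.exists_subset_card_eq (hs.trans_eq (Set.ncard_univ ρ).symm)
  obtain ⟨j₀⟩ := ‹Nonempty κ›
  refine ⟨Set.univ ×ˢ {j₀}ᶜ ∪ R ×ˢ {j₀}, fullRowMatroid_indep_iff.2 ?_, ?_⟩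
  · exact (Set.ncard_le_ncard fun i hi => by simpa using hi j₀).trans_eq hR
  · rw [Set.ncard_union_eq (Set.disjoint_prod.2 (.inr disjoint_compl_left)), Set.ncard_prod,
      Set.ncard_prod, Set.ncard_univ, Set.ncard_compl, Set.ncard_singleton, hR, mul_one]

end FullRows

section ConfigurationSpace

variable {V : Type*} {k r s : ℕ} {c : V → Fin (k + 1)}

theorem isRainbow_iff_injOn {A : Finset V} : IsRainbow c A ↔ Set.InjOn c A := by
  simp only [IsRainbow, card_le_one, mem_filter]
  exact ⟨fun h v hv w hw hvw => h (c w) v ⟨hv, hvw⟩ w ⟨hw, rfl⟩,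
    fun h i v hv w hw => h hv.1 hw.1 (hv.2.trans hw.2.symm)⟩

theorem IsRainbow.card_eq_iff {A : Finset V} (h : IsRainbow c A) :
    #A = k + 1 ↔ ∀ j, ∃ v ∈ A, c v = j := by
  rw [← card_image_of_injOn (isRainbow_iff_injOn.1 h)]
  simpa [eq_univ_iff_forall] using card_eq_iff_eq_univ (A.image c)

/-- The position of a vertex of the join: its copy of `V` together with its color. -/
def slot (c : V → Fin (k + 1)) (p : Fin r × V) : Fin r × Fin (k + 1) :=
  (p.1, c p.2)

variable [Fintype V]

theorem hasManyNbrs_slot (hc : ∀ j, 2 * r ≤ #{v | c v = j} + 1)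
    (S : Set (Fin r × Fin (k + 1))) :
    HasManyNbrs (slot c) (Prod.snd : Fin r × V → V) .univ S := by
  have hnbrs (e : Fin r × Fin (k + 1)) : nbrs (slot c) Prod.snd .univ e = {v | c v = e.2} := by
    ext v
    simp [nbrs, slot, Prod.ext_iff]
  rintro ⟨i, j⟩ -
  have hconflict : {e ∈ S \ {(i, j)} | ¬Disjoint (nbrs (slot c) Prod.snd .univ e)
      (nbrs (slot c) Prod.snd .univ (i, j))} ⊆ {i}ᶜ ×ˢ {j} := by
    rintro ⟨i', j'⟩ ⟨⟨-, hne⟩, hd⟩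
    obtain ⟨v, hv, hv'⟩ := Set.not_disjoint_iff.1 hd
    rw [hnbrs] at hv hv'
    have hj : j' = j := hv.symm.trans hv'
    exact ⟨fun hi => hne (Prod.ext hi hj), hj⟩
  have hconflict_card := Set.ncard_le_ncard hconflict
  rw [Set.ncard_prod, Set.ncard_compl, Set.ncard_singleton, Set.ncard_singleton, Nat.card_fin]
    at hconflict_card
  have hdegree : (nbrs (slot c) Prod.snd .univ (i, j)).ncard = #{v | c v = j} := by
    rw [hnbrs, ← Set.ncard_coe_finset]
    simp
  have := hc j
  have := i.pos
  omega

variable [DecidableEq V] {σ : Finset (Fin r × V)}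

theorem mem_joinPart {i : Fin r} {v : V} : v ∈ joinPart σ i ↔ (i, v) ∈ σ := by
  simp [joinPart]

theorem forall_isRainbow_joinPart_iff :
    (∀ i, IsRainbow c (joinPart σ i)) ↔ Set.InjOn (slot c) (σ : Set (Fin r × V)) := by
  simp only [isRainbow_iff_injOn, Set.InjOn, mem_coe, mem_joinPart, slot, Prod.forall,
    Prod.mk.injEq]
  constructor
  · rintro h i v hv i' w hw ⟨rfl, hvw⟩
    exact ⟨rfl, h i hv hw hvw⟩
  · exact fun h i v hv w hw hvw => (h i v hv i w hw ⟨rfl, hvw⟩).2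

theorem forall_disjoint_joinPart_iff :
    (∀ i j, i ≠ j → Disjoint (joinPart σ i) (joinPart σ j)) ↔
      Set.InjOn Prod.snd (σ : Set (Fin r × V)) := by
  simp only [disjoint_left, Set.InjOn, mem_coe, mem_joinPart, Prod.forall, Prod.mk.injEq]
  constructor
  · rintro h i v hv j w hw rfl
    exact ⟨by_contra fun hij => h i j hij hv hw, rfl⟩
  · exact fun h i j hij v hv hw => hij (h i v hv j v hw rfl).1

theorem card_full_joinPart_eq (h : ∀ i, IsRainbow c (joinPart σ i)) :
    #{i | #(joinPart σ i) = k + 1} =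
      {i | ∀ j, (i, j) ∈ slot c '' (σ : Set (Fin r × V))}.ncard := by
  rw [← Set.ncard_coe_finset]
  congr 1
  ext i
  simp [(h i).card_eq_iff, mem_joinPart, slot]

theorem mem_configurationSpace_iff :
    σ ∈ configurationSpace c r s ↔ σ.Nonempty ∧
      σ ∈ independentMatchings (slot c) Prod.snd
        (fullRowMatroid (Fin r) (Fin (k + 1)) s) .univ := by
  change (_ ∧ _ ∧ _ ∧ _) ↔ _ ∧ _ ∧ _ ∧ _ ∧ _
  rw [forall_disjoint_joinPart_iff, fullRowMatroid_indep_iff, ← forall_isRainbow_joinPart_iff]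
  constructor
  · rintro ⟨hne, hd, hr, hs⟩
    exact ⟨hne, Set.subset_univ _, hd, (card_full_joinPart_eq hr).ge.trans hs, hr⟩
  · rintro ⟨hne, -, hd, hs, hr⟩
    exact ⟨hne, hd, hr, (card_full_joinPart_eq hr).le.trans hs⟩

theorem geometricRealization_configurationSpace :
    geometricRealization (configurationSpace c r s) = polyhedron
      (independentMatchings (slot c) Prod.snd (fullRowMatroid (Fin r) (Fin (k + 1)) s) .univ) := by
  ext x
  refine and_congr_right fun hx => exists_congr fun σ => ?_
  rw [mem_configurationSpace_iff, and_assoc, and_iff_right_iff_imp]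
  rintro ⟨-, h⟩
  by_contra hσ
  obtain rfl := not_nonempty_iff_eq_empty.1 hσ
  simpa [h] using hx.2

end ConfigurationSpace

theorem proposition3p2_general {V : Type*} [Fintype V] [DecidableEq V] {r k s : ℕ} (hsr : s ≤ r)
    {c : V → Fin (k + 1)} (hc : ∀ i, 2 * r ≤ #{v | c v = i} + 1) :
    IsNConnected ((r * k + s : ℕ) - 2 : ℤ)
      (geometricRealization (configurationSpace c r s)) := by
  obtain ⟨I, hI, hIcard⟩ := exists_fullRowMatroid_indep_ncard_eq (ρ := Fin r) (κ := Fin (k + 1))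
    (hsr.trans_eq (Nat.card_fin r).symm)
  rw [Nat.card_fin, Nat.card_fin, Nat.add_sub_cancel] at hIcard
  rw [geometricRealization_configurationSpace, ← hIcard]
  exact (MorseBuilt.independentMatchings_of_indep hI (hasManyNbrs_slot hc _)).isNConnected
    ⟨∅, empty_mem_independentMatchings⟩

theorem proposition3p2 {V : Type*} [Fintype V] [DecidableEq V] (r k s : ℕ)
    (hs : 0 < s) (hsr : s ≤ r)
    (c : V → Fin (k + 1)) (hc : ∀ i, #{v | c v = i} = 2 * r - 1) :
    IsNConnected ((r * k + s : ℕ) - 2 : ℤ)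
      (geometricRealization (configurationSpace c r s)) :=
  proposition3p2_general hsr fun i => by have := hc i; omega
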